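/- Fix integers $m\ge 2$ and $n\ge 2^m-1$, and let $p_1,\dots,p_n\ge 0$ with $\sum_i p_i=1$ be the probabilities of source symbols $\sigma_1,\dots,\sigma_n$. A code tree is a finite rooted binary tree with edges labelled $0$ or $1$ (nodes are identified with the words leading to them) in which every node is exactly one of the following: a complete node (no symbol assigned, a $0$-child and a $1$-child); an intermediate-$0$ node (resp. intermediate-$1$ node) (no symbol assigned, exactly one child, which is a $0$-child (resp. $1$-child)); or a master node (exactly one symbol assigned). A master node either is a leaf and has degree $0$, or it has exactly one child, a $0$-child, and degree $d\ge1$, meaning that $v0^t$ is an intermediate-$0$ node for $1\le t\le d$ while $v0^{d+1}$ is not. For $0\le k\le m-1$ let $\mathcal T_k(m,n)$ be the set of code trees in which all master nodes have degree at most $m-1$, each symbol $\sigma_i$ is assigned to exactly one master node, and, if $k\ge1$, the node $0^k$ exists and is an intermediate-$1$ node. For $T\in\mathcal T_k(m,n)$ let $\ell(T)=\sum_i p_i\,\ell(T,\sigma_i)$, where $\ell(T,\sigma_i)$ is the depth of the master node assigned $\sigma_i$, and let $q_j(T)$ be the sum of the $p_i$ over all $i$ for which $\sigma_i$ is assigned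 to a master node of degree $j$. For $\mathbf x=(x_1,\dots,x_{m-1})\in\mathbb R^{m-1}$ put $$g_0(\mathbf x)=\min_{T\in\mathcal T_0(m,n)}\Big(\ell(T)+\sum_{j=1}^{m-1}q_j(T)x_j\Big),\qquad g_k(\mathbf x)=\min_{T\in\mathcal T_k(m,n)}\Big(\ell(T)+\sum_{j=1}^{m-1}q_j(T)x_j\Big)-x_k\quad(1\le k\le m-1).$$ Then for every $\mathbf x\in[0,1]^{m-1}$ and every $k\in\{1,\dots,m-1\}$ the minima defining $g_0(\mathbf x)$ and $g_k(\mathbf x)$ are attained, and - if $x_k=0$, then $g_0(\mathbf x)-g_k(\mathbf x)\le 0$; - if $x_k=1$, then $g_k(\mathbf x)-g_0(\mathbf x)\le 0$. -/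

import Mathlib

namespace AIFV

/-- Finite binary code trees over a set `α` of source symbols, built from the node types of binary
AIFV codes. `0`-edges are written `false`, `1`-edges `true`. -/
inductive CodeTree (α : Type) : Type
  /-- a leaf: a master node without a child, with its source symbol -/
  | leaf (a : α) : CodeTree α
  /-- a master node with its source symbol and a unique child, along a `0`-edge -/
  | master (a : α) (t : CodeTree α) : CodeTree α
  /-- an intermediate-`0` node: no source symbol, a unique child, along a `0`-edge -/
  | inter0 (t : CodeTree α) : CodeTree α
  /-- an intermediate-`1` node: no source symbol, a unique child, along a `1`-edge -/
  | inter1 (t : CodeTree α) : CodeTree α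
  /-- a complete node: no source symbol, a `0`-child and a `1`-child -/
  | complete (t₀ t₁ : CodeTree α) : CodeTree α

namespace CodeTree

variable {α : Type}

/-- The subtree rooted at the node reached from the root by the word `w`
(`none` if there is no such node). -/
def subtreeAt : CodeTree α → List Bool → Option (CodeTree α)
  | t, [] => some t
  | master _ t, false :: w => t.subtreeAt w
  | inter0 t, false :: w => t.subtreeAt w
  | inter1 t, true :: w => t.subtreeAt w
  | complete t₀ _, false :: w => t₀.subtreeAt w
  | complete _ t₁, true :: w => t₁.subtreeAt w
  | _, _ :: _ => none

/-- The number of consecutive intermediate-`0` nodes that start at the root. -/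
def run0 : CodeTree α → ℕ
  | inter0 t => t.run0 + 1
  | _ => 0

/-- The source symbol assigned to the root, if the root is a master node. -/
def rootSymbol : CodeTree α → Option α
  | leaf a => some a
  | master a _ => some a
  | _ => none

/-- The degree of the root as a master node (`0` by convention if it is not a master node). -/
def rootDegree : CodeTree α → ℕ
  | master _ t => t.run0
  | _ => 0

/-- The node `w` exists and is a master node with source symbol `a`. -/
def IsMasterOf (T : CodeTree α) (w : List Bool) (a : α) : Prop :=
  ∃ S, T.subtreeAt w = some S ∧ S.rootSymbol = some a

/-- The node `w` exists and is an intermediate-`1` node. -/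
def IsInter1 (T : CodeTree α) (w : List Bool) : Prop :=
  ∃ S, T.subtreeAt w = some (inter1 S)

/-- Every master node has a degree `< m`; a master node that is not a leaf has a degree `≥ 1`. -/
def DegreesOK (m : ℕ) (T : CodeTree α) : Prop :=
  ∀ w a S, T.subtreeAt w = some (master a S) → 1 ≤ S.run0 ∧ S.run0 < m

open Classical in
/-- The codeword of the symbol `a`: the word of the master node to which `a` is assigned
(meaningful when there is exactly one such node). -/
noncomputable def codeword (T : CodeTree α) (a : α) : List Bool :=
  Classical.epsilon fun w => T.IsMasterOf w a

/-- The length of the codeword of `a`. -/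
noncomputable def codeLength (T : CodeTree α) (a : α) : ℕ := (T.codeword a).length

/-- The degree of the master node to which `a` is assigned. -/
noncomputable def degree (T : CodeTree α) (a : α) : ℕ :=
  match T.subtreeAt (T.codeword a) with
  | some S => S.rootDegree
  | none => 0

end CodeTree

/-- The type-`k` trees of binary AIFV-`m` codes on `n` source symbols (for `k < m`). -/
def trees (m n k : ℕ) : Set (CodeTree (Fin n)) :=
  {T | T.DegreesOK m ∧
    (∀ i : Fin n, ∃! w : List Bool, T.IsMasterOf w i) ∧
    (1 ≤ k → T.IsInter1 (List.replicate k false))}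

/-- Average codeword length `ℓ(T)` with symbol probabilities `p`. -/
noncomputable def avgLength {n : ℕ} (p : Fin n → ℝ) (T : CodeTree (Fin n)) : ℝ :=
  ∑ i, (T.codeLength i : ℝ) * p i

/-- `q_j(T)`: the probability that a symbol is encoded by a master node of degree `j`. -/
noncomputable def trans {n : ℕ} (p : Fin n → ℝ) (T : CodeTree (Fin n)) (j : ℕ) : ℝ :=
  ∑ i with T.degree i = j, p i

/-- The type-`k` hyperplane `f_k(x, T)`, where `x = (x_1, …, x_{m-1})`:
`ℓ(T) + ∑_{j=1}^{m-1} q_j(T) x_j`, minus `x_k` if `k ≥ 1`. -/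
noncomputable def hyper (m : ℕ) {n : ℕ} (p : Fin n → ℝ) (k : ℕ) (x : Finset.Icc 1 (m - 1) → ℝ)
    (T : CodeTree (Fin n)) : ℝ :=
  avgLength p T + ∑ j : Finset.Icc 1 (m - 1), trans p T j * x j
    - (if h : k ∈ Finset.Icc 1 (m - 1) then x ⟨k, h⟩ else 0)

/-- The values of the type-`k` hyperplanes at `x`. -/
def values (m : ℕ) {n : ℕ} (p : Fin n → ℝ) (k : ℕ) (x : Finset.Icc 1 (m - 1) → ℝ) : Set ℝ :=
  hyper m p k x '' trees m n k

/-- The lower envelope `g_k(x)` of the type-`k` hyperplanes. -/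
noncomputable def envelope (m : ℕ) {n : ℕ} (p : Fin n → ℝ) (k : ℕ)
    (x : Finset.Icc 1 (m - 1) → ℝ) : ℝ :=
  sInf (values m p k x)

end AIFV

namespace AIFV

namespace CodeTree

variable {α : Type}

/-! Every type-`k` tree is a type-`0` tree, so the first inequality is an inclusion once `x_k = 0`.
For the second, a type-`0` tree `T` is made into a type-`k` tree at extra cost at most `1 = x_k`. As
`2 ^ k ≤ n`, and only `2 ^ k - 1` words are shorter than `k`, some symbol `a` has depth at least
`k`. Delete `a` from `T` (`exists_remove`) and join the result, under a complete root, to a path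
carrying `a` at depth `k + 1` and making `0^k` an intermediate-`1` node. No codeword grows by more
than one; every degree is kept or drops to `0`, which is free since `x ≥ 0`.

There are infinitely many trees, so attainment needs an argument (`isLeast_envelope`): for fixed
degrees the cost is monotone in the vector of lengths in `ℕ^n`, and Dickson's lemma makes the set of
values well-founded. -/

/-- The source symbols of a tree, in preorder. -/
def syms : CodeTree α → List α
  | leaf a => [a]
  | master a t => a :: t.syms
  | inter0 t => t.syms
  | inter1 t => t.syms
  | complete t₀ t₁ => t₀.syms ++ t₁.syms

/-- The tree without the intermediate-`0` nodes that start at its root. -/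
def strip : CodeTree α → CodeTree α
  | inter0 t => t.strip
  | t => t

/-- Some master node of depth `l` and degree `d` has the source symbol `a`. -/
def Entry (T : CodeTree α) (a : α) (l d : ℕ) : Prop :=
  ∃ w S, T.subtreeAt w = some S ∧ S.rootSymbol = some a ∧ w.length = l ∧ S.rootDegree = d

/-! ### Recursive descriptions of entries, degrees and codewords -/

section Recursion

variable {a b : α} {l d m : ℕ} {w : List Bool} {t t₀ t₁ : CodeTree α}

theorem entry_leaf : (leaf b).Entry a l d ↔ a = b ∧ l = 0 ∧ d = 0 := by
  constructor
  · rintro ⟨_ | ⟨_ | _, w⟩, S, h, hs, rfl, rfl⟩ <;> simp [subtreeAt] at h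
    subst h
    simp_all [rootSymbol, rootDegree]
  · rintro ⟨rfl, rfl, rfl⟩
    exact ⟨[], _, subtreeAt.eq_1 _, rfl, rfl, rfl⟩

theorem entry_master : (master b t).Entry a l d ↔
    (a = b ∧ l = 0 ∧ d = t.run0) ∨ ∃ l', l = l' + 1 ∧ t.Entry a l' d := by
  constructor
  · rintro ⟨_ | ⟨_ | _, w⟩, S, h, hs, rfl, rfl⟩ <;> simp [subtreeAt] at h
    · subst h
      simp_all [rootSymbol, rootDegree]
    · exact Or.inr ⟨_, rfl, w, S, h, hs, rfl, rfl⟩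
  · rintro (⟨rfl, rfl, rfl⟩ | ⟨l', rfl, w, S, h, hs, rfl, rfl⟩)
    · exact ⟨[], _, subtreeAt.eq_1 _, rfl, rfl, rfl⟩
    · exact ⟨false :: w, S, by simpa [subtreeAt], hs, rfl, rfl⟩

theorem entry_inter0 : (inter0 t).Entry a l d ↔ ∃ l', l = l' + 1 ∧ t.Entry a l' d := by
  constructor
  · rintro ⟨_ | ⟨_ | _, w⟩, S, h, hs, rfl, rfl⟩ <;> simp [subtreeAt] at h
    · subst h
      simp [rootSymbol] at hs
    · exact ⟨_, rfl, w, S, h, hs, rfl, rfl⟩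
  · rintro ⟨l', rfl, w, S, h, hs, rfl, rfl⟩
    exact ⟨false :: w, S, by simpa [subtreeAt], hs, rfl, rfl⟩

theorem entry_inter1 : (inter1 t).Entry a l d ↔ ∃ l', l = l' + 1 ∧ t.Entry a l' d := by
  constructor
  · rintro ⟨_ | ⟨_ | _, w⟩, S, h, hs, rfl, rfl⟩ <;> simp [subtreeAt] at h
    · subst h
      simp [rootSymbol] at hs
    · exact ⟨_, rfl, w, S, h, hs, rfl, rfl⟩
  · rintro ⟨l', rfl, w, S, h, hs, rfl, rfl⟩
    exact ⟨true :: w, S, by simpa [subtreeAt], hs, rfl, rfl⟩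

theorem entry_complete : (complete t₀ t₁).Entry a l d ↔
    ∃ l', l = l' + 1 ∧ (t₀.Entry a l' d ∨ t₁.Entry a l' d) := by
  constructor
  · rintro ⟨_ | ⟨_ | _, w⟩, S, h, hs, rfl, rfl⟩ <;> simp [subtreeAt] at h
    · subst h
      simp [rootSymbol] at hs
    · exact ⟨_, rfl, Or.inl ⟨w, S, h, hs, rfl, rfl⟩⟩
    · exact ⟨_, rfl, Or.inr ⟨w, S, h, hs, rfl, rfl⟩⟩
  · rintro ⟨l', rfl, ⟨w, S, h, hs, rfl, rfl⟩ | ⟨w, S, h, hs, rfl, rfl⟩⟩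
    · exact ⟨false :: w, S, by simpa [subtreeAt], hs, rfl, rfl⟩
    · exact ⟨true :: w, S, by simpa [subtreeAt], hs, rfl, rfl⟩

theorem degreesOK_leaf : (leaf b).DegreesOK m := by
  rintro (_ | ⟨_ | _, w⟩) a S h <;> simp [subtreeAt] at h

theorem degreesOK_master : (master b t).DegreesOK m ↔
    (1 ≤ t.run0 ∧ t.run0 < m) ∧ t.DegreesOK m := by
  constructor
  · exact fun h => ⟨h [] b t (by simp [subtreeAt]),
      fun w a S hw => h (false :: w) a S (by simpa [subtreeAt])⟩
  · rintro ⟨h, h'⟩ (_ | ⟨_ | _, w⟩) a S hw <;> simp [subtreeAt] at hw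
    · obtain ⟨rfl, rfl⟩ := hw
      exact h
    · exact h' w a S hw

theorem degreesOK_inter0 : (inter0 t).DegreesOK m ↔ t.DegreesOK m := by
  constructor
  · exact fun h w a S hw => h (false :: w) a S (by simpa [subtreeAt])
  · rintro h' (_ | ⟨_ | _, w⟩) a S hw <;> simp [subtreeAt] at hw
    exact h' w a S hw

theorem degreesOK_inter1 : (inter1 t).DegreesOK m ↔ t.DegreesOK m := by
  constructor
  · exact fun h w a S hw => h (true :: w) a S (by simpa [subtreeAt])
  · rintro h' (_ | ⟨_ | _, w⟩) a S hw <;> simp [subtreeAt] at hw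
    exact h' w a S hw

theorem degreesOK_complete : (complete t₀ t₁).DegreesOK m ↔ t₀.DegreesOK m ∧ t₁.DegreesOK m := by
  constructor
  · exact fun h => ⟨fun w a S hw => h (false :: w) a S (by simpa [subtreeAt]),
      fun w a S hw => h (true :: w) a S (by simpa [subtreeAt])⟩
  · rintro ⟨h, h'⟩ (_ | ⟨_ | _, w⟩) a S hw <;> simp [subtreeAt] at hw
    · exact h w a S hw
    · exact h' w a S hw

theorem run0_strip (T : CodeTree α) : T.strip.run0 = 0 := by
  induction T <;> simp_all [strip, run0]

theorem syms_strip (T : CodeTree α) : T.strip.syms = T.syms := by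
  induction T <;> simp_all [strip, syms]

theorem DegreesOK.strip {T : CodeTree α} (h : T.DegreesOK m) : T.strip.DegreesOK m := by
  induction T with
  | inter0 t ih => exact ih (degreesOK_inter0.1 h)
  | _ => exact h

/-- Only symbol-free nodes above the master node disappear, so its degree is untouched. -/
theorem Entry.strip {T : CodeTree α} (h : T.Entry a l d) : ∃ l' ≤ l, T.strip.Entry a l' d := by
  induction T generalizing l with
  | inter0 t ih =>
    obtain ⟨l', rfl, h'⟩ := entry_inter0.1 h
    obtain ⟨l'', hl, h⟩ := ih h'
    exact ⟨l'', by omega, h⟩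
  | _ => exact ⟨l, le_rfl, h⟩

theorem isMasterOf_leaf : (leaf b).IsMasterOf w a ↔ w = [] ∧ b = a := by
  rcases w with _ | ⟨_ | _, w⟩ <;> simp [IsMasterOf, subtreeAt, rootSymbol]

theorem isMasterOf_nil : t.IsMasterOf [] a ↔ t.rootSymbol = some a := by
  simp [IsMasterOf, subtreeAt]

theorem isMasterOf_master_cons {c : Bool} : (master b t).IsMasterOf (c :: w) a ↔
    c = false ∧ t.IsMasterOf w a := by
  cases c <;> simp [IsMasterOf, subtreeAt]

theorem isMasterOf_inter0_cons {c : Bool} : (inter0 t).IsMasterOf (c :: w) a ↔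
    c = false ∧ t.IsMasterOf w a := by
  cases c <;> simp [IsMasterOf, subtreeAt]

theorem isMasterOf_inter1_cons {c : Bool} : (inter1 t).IsMasterOf (c :: w) a ↔
    c = true ∧ t.IsMasterOf w a := by
  cases c <;> simp [IsMasterOf, subtreeAt]

theorem isMasterOf_complete_cons {c : Bool} : (complete t₀ t₁).IsMasterOf (c :: w) a ↔
    (c = false ∧ t₀.IsMasterOf w a) ∨ (c = true ∧ t₁.IsMasterOf w a) := by
  cases c <;> simp [IsMasterOf, subtreeAt]

end Recursion

/-! ### Unique assignment of symbols, read off the preorder list -/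

theorem mem_syms_iff {T : CodeTree α} {a : α} : a ∈ T.syms ↔ ∃ w, T.IsMasterOf w a := by
  induction T with
  | leaf b => simp [syms, isMasterOf_leaf, eq_comm]
  | master b t ih =>
    rw [syms, List.mem_cons, ih]
    constructor
    · rintro (rfl | ⟨w, h⟩)
      · exact ⟨[], isMasterOf_nil.2 rfl⟩
      · exact ⟨false :: w, isMasterOf_master_cons.2 ⟨rfl, h⟩⟩
    · rintro ⟨_ | ⟨c, w⟩, h⟩
      · left
        simpa [rootSymbol, eq_comm] using isMasterOf_nil.1 h
      · exact Or.inr ⟨w, (isMasterOf_master_cons.1 h).2⟩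
  | inter0 t ih =>
    rw [syms, ih]
    constructor
    · rintro ⟨w, h⟩
      exact ⟨false :: w, isMasterOf_inter0_cons.2 ⟨rfl, h⟩⟩
    · rintro ⟨_ | ⟨c, w⟩, h⟩
      · simp [isMasterOf_nil, rootSymbol] at h
      · exact ⟨w, (isMasterOf_inter0_cons.1 h).2⟩
  | inter1 t ih =>
    rw [syms, ih]
    constructor
    · rintro ⟨w, h⟩
      exact ⟨true :: w, isMasterOf_inter1_cons.2 ⟨rfl, h⟩⟩
    · rintro ⟨_ | ⟨c, w⟩, h⟩
      · simp [isMasterOf_nil, rootSymbol] at h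
      · exact ⟨w, (isMasterOf_inter1_cons.1 h).2⟩
  | complete t₀ t₁ ih₀ ih₁ =>
    rw [syms, List.mem_append, ih₀, ih₁]
    constructor
    · rintro (⟨w, h⟩ | ⟨w, h⟩)
      · exact ⟨false :: w, isMasterOf_complete_cons.2 (Or.inl ⟨rfl, h⟩)⟩
      · exact ⟨true :: w, isMasterOf_complete_cons.2 (Or.inr ⟨rfl, h⟩)⟩
    · rintro ⟨_ | ⟨c, w⟩, h⟩
      · simp [isMasterOf_nil, rootSymbol] at h
      · exact (isMasterOf_complete_cons.1 h).imp (fun h => ⟨w, h.2⟩) (fun h => ⟨w, h.2⟩)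

theorem nodup_syms_iff {T : CodeTree α} :
    T.syms.Nodup ↔ ∀ a w w', T.IsMasterOf w a → T.IsMasterOf w' a → w = w' := by
  induction T with
  | leaf b => simp +contextual [syms, isMasterOf_leaf]
  | master b t ih =>
    rw [syms, List.nodup_cons, ih, mem_syms_iff]
    constructor
    · rintro ⟨hb, h⟩ a (_ | ⟨c, w⟩) (_ | ⟨c', w'⟩) h₁ h₂ <;>
        simp [isMasterOf_nil, isMasterOf_master_cons, rootSymbol] at h₁ h₂ ⊢
      · subst h₁
        exact hb ⟨_, h₂.2⟩
      · subst h₂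
        exact hb ⟨_, h₁.2⟩
      · exact ⟨by rw [h₁.1, h₂.1], h _ _ _ h₁.2 h₂.2⟩
    · intro h
      refine ⟨?_, fun a w w' h₁ h₂ => ?_⟩
      · rintro ⟨w, hw⟩
        simpa using h b [] (false :: w) (isMasterOf_nil.2 rfl) (isMasterOf_master_cons.2 ⟨rfl, hw⟩)
      · simpa using h a (false :: w) (false :: w') (isMasterOf_master_cons.2 ⟨rfl, h₁⟩)
          (isMasterOf_master_cons.2 ⟨rfl, h₂⟩)
  | inter0 t ih =>
    rw [syms, ih]
    constructor
    · rintro h a (_ | ⟨c, w⟩) (_ | ⟨c', w'⟩) h₁ h₂ <;>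
        simp [isMasterOf_nil, isMasterOf_inter0_cons, rootSymbol] at h₁ h₂ ⊢
      exact ⟨by rw [h₁.1, h₂.1], h _ _ _ h₁.2 h₂.2⟩
    · intro h a w w' h₁ h₂
      simpa using h a (false :: w) (false :: w') (isMasterOf_inter0_cons.2 ⟨rfl, h₁⟩)
        (isMasterOf_inter0_cons.2 ⟨rfl, h₂⟩)
  | inter1 t ih =>
    rw [syms, ih]
    constructor
    · rintro h a (_ | ⟨c, w⟩) (_ | ⟨c', w'⟩) h₁ h₂ <;>
        simp [isMasterOf_nil, isMasterOf_inter1_cons, rootSymbol] at h₁ h₂ ⊢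
      exact ⟨by rw [h₁.1, h₂.1], h _ _ _ h₁.2 h₂.2⟩
    · intro h a w w' h₁ h₂
      simpa using h a (true :: w) (true :: w') (isMasterOf_inter1_cons.2 ⟨rfl, h₁⟩)
        (isMasterOf_inter1_cons.2 ⟨rfl, h₂⟩)
  | complete t₀ t₁ ih₀ ih₁ =>
    rw [syms, List.nodup_append', ih₀, ih₁]
    constructor
    · rintro ⟨h, h', hd⟩ a (_ | ⟨c, w⟩) (_ | ⟨c', w'⟩) h₁ h₂ <;>
        simp only [isMasterOf_nil, isMasterOf_complete_cons, rootSymbol, reduceCtorEq] at h₁ h₂ ⊢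
      rcases h₁ with ⟨rfl, h₁⟩ | ⟨rfl, h₁⟩ <;> rcases h₂ with ⟨rfl, h₂⟩ | ⟨rfl, h₂⟩
      · rw [h a w w' h₁ h₂]
      · exact (hd (mem_syms_iff.2 ⟨_, h₁⟩) (mem_syms_iff.2 ⟨_, h₂⟩)).elim
      · exact (hd (mem_syms_iff.2 ⟨_, h₂⟩) (mem_syms_iff.2 ⟨_, h₁⟩)).elim
      · rw [h' a w w' h₁ h₂]
    · intro h
      refine ⟨fun a w w' h₁ h₂ => ?_, fun a w w' h₁ h₂ => ?_, fun a h₁ h₂ => ?_⟩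
      · simpa using h a (false :: w) (false :: w') (isMasterOf_complete_cons.2 (Or.inl ⟨rfl, h₁⟩))
          (isMasterOf_complete_cons.2 (Or.inl ⟨rfl, h₂⟩))
      · simpa using h a (true :: w) (true :: w') (isMasterOf_complete_cons.2 (Or.inr ⟨rfl, h₁⟩))
          (isMasterOf_complete_cons.2 (Or.inr ⟨rfl, h₂⟩))
      · obtain ⟨w, h₁⟩ := mem_syms_iff.1 h₁
        obtain ⟨w', h₂⟩ := mem_syms_iff.1 h₂
        simpa using h a (false :: w) (true :: w') (isMasterOf_complete_cons.2 (Or.inl ⟨rfl, h₁⟩))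
          (isMasterOf_complete_cons.2 (Or.inr ⟨rfl, h₂⟩))

/-! ### Deleting a symbol -/

/-- A symbol can be removed from a tree with another symbol, without lengthening any codeword, and
such that every master node keeps its degree or becomes a leaf. -/
theorem exists_remove [DecidableEq α] (a : α) (T : CodeTree α) :
    T.syms.filter (· ≠ a) = [] ∨
    ∃ R : CodeTree α, R.syms = T.syms.filter (· ≠ a) ∧ R.run0 = T.run0 ∧
      (∀ m, T.DegreesOK m → R.DegreesOK m) ∧
      ∀ b l d, b ≠ a → T.Entry b l d → ∃ l' d', l' ≤ l ∧ (d' = d ∨ d' = 0) ∧ R.Entry b l' d' := by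
  -- The clause on `run0` is what the induction needs: the degree of a master node is the `run0` of
  -- its child.
  induction T with
  | leaf c =>
    by_cases hc : c = a
    · left
      simp [syms, hc]
    · exact Or.inr ⟨leaf c, by simp [syms, hc], rfl, fun _ h => h,
        fun b l d _ h => ⟨l, d, le_rfl, Or.inl rfl, h⟩⟩
  | master c t ih =>
    by_cases hc : c = a
    · subst hc
      rcases ih with h | ⟨R, hs, hr, hd, he⟩
      · left
        simpa [syms] using h
      -- The deleted node ended any run of intermediate-`0` nodes above it. Stripping keeps `run0`
      -- equal to `0`, so that such a run does not merge with the one below and raise a degree.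
      · refine Or.inr ⟨R.strip, by simpa [syms, syms_strip] using hs, run0_strip R,
          fun m h => (hd m (degreesOK_master.1 h).2).strip, fun b l d hb h => ?_⟩
        rcases entry_master.1 h with ⟨rfl, -⟩ | ⟨l₁, rfl, h₁⟩
        · exact (hb rfl).elim
        · obtain ⟨l₂, d₂, hl, hd₂, h⟩ := he b l₁ d hb h₁
          obtain ⟨l₃, hl₃, h⟩ := h.strip
          exact ⟨l₃, d₂, by omega, hd₂, h⟩
    · right
      rcases ih with h | ⟨R, hs, hr, hd, he⟩
      -- Nothing is left below `c`, so it becomes a leaf: here a degree drops to `0`.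
      · refine ⟨leaf c, ?_, rfl, fun _ _ => degreesOK_leaf, fun b l d hb hE => ?_⟩
        · rw [syms, syms, List.filter_cons_of_pos (by simpa using hc), h]
        · rcases entry_master.1 hE with ⟨rfl, rfl, -⟩ | ⟨l₁, rfl, hE'⟩
          · exact ⟨0, 0, le_rfl, Or.inr rfl, entry_leaf.2 ⟨rfl, rfl, rfl⟩⟩
          · obtain ⟨w, S, h₁, h₂, -⟩ := hE'
            have : b ∈ t.syms.filter (· ≠ a) :=
              List.mem_filter.2 ⟨mem_syms_iff.2 ⟨w, S, h₁, h₂⟩, by simpa using hb⟩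
            rw [h] at this
            exact (List.not_mem_nil this).elim
      · refine ⟨master c R, ?_, rfl, fun m h => ?_, fun b l d hb h => ?_⟩
        · rw [syms, syms, List.filter_cons_of_pos (by simpa using hc), hs]
        · rw [degreesOK_master] at h ⊢
          exact ⟨hr ▸ h.1, hd m h.2⟩
        · rcases entry_master.1 h with ⟨rfl, rfl, rfl⟩ | ⟨l₁, rfl, h₁⟩
          · exact ⟨0, _, le_rfl, Or.inl rfl, entry_master.2 (Or.inl ⟨rfl, rfl, hr.symm⟩)⟩
          · obtain ⟨l₂, d₂, hl, hd₂, h⟩ := he b l₁ d hb h₁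
            exact ⟨l₂ + 1, d₂, by omega, hd₂, entry_master.2 (Or.inr ⟨l₂, rfl, h⟩)⟩
  | inter0 t ih =>
    rcases ih with h | ⟨R, hs, hr, hd, he⟩
    · exact Or.inl h
    · refine Or.inr ⟨inter0 R, hs, by rw [run0, run0, hr], fun m h =>
        degreesOK_inter0.2 (hd m (degreesOK_inter0.1 h)), fun b l d hb h => ?_⟩
      obtain ⟨l₁, rfl, h₁⟩ := entry_inter0.1 h
      obtain ⟨l₂, d₂, hl, hd₂, h⟩ := he b l₁ d hb h₁
      exact ⟨l₂ + 1, d₂, by omega, hd₂, entry_inter0.2 ⟨l₂, rfl, h⟩⟩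
  | inter1 t ih =>
    rcases ih with h | ⟨R, hs, hr, hd, he⟩
    · exact Or.inl h
    · refine Or.inr ⟨inter1 R, hs, rfl, fun m h =>
        degreesOK_inter1.2 (hd m (degreesOK_inter1.1 h)), fun b l d hb h => ?_⟩
      obtain ⟨l₁, rfl, h₁⟩ := entry_inter1.1 h
      obtain ⟨l₂, d₂, hl, hd₂, h⟩ := he b l₁ d hb h₁
      exact ⟨l₂ + 1, d₂, by omega, hd₂, entry_inter1.2 ⟨l₂, rfl, h⟩⟩
  | complete t₀ t₁ ih₀ ih₁ =>
    have absurd_entry : ∀ t : CodeTree α, t.syms.filter (· ≠ a) = [] → ∀ b l d, b ≠ a →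
        ¬ t.Entry b l d := by
      rintro t ht b l d hb ⟨w, S, h₁, h₂, -⟩
      have : b ∈ t.syms.filter (· ≠ a) :=
        List.mem_filter.2 ⟨mem_syms_iff.2 ⟨w, S, h₁, h₂⟩, by simpa using hb⟩
      rw [ht] at this
      exact (List.not_mem_nil this).elim
    rw [syms, List.filter_append]
    rcases ih₀ with h₀ | ⟨R₀, hs₀, hr₀, hd₀, he₀⟩ <;>
      rcases ih₁ with h₁ | ⟨R₁, hs₁, hr₁, hd₁, he₁⟩
    · left
      rw [h₀, h₁, List.append_nil]
    · refine Or.inr ⟨inter1 R₁, by rw [syms, hs₁, h₀, List.nil_append], rfl, fun m h =>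
        degreesOK_inter1.2 (hd₁ m (degreesOK_complete.1 h).2), fun b l d hb h => ?_⟩
      obtain ⟨l₁, rfl, h | h⟩ := entry_complete.1 h
      · exact (absurd_entry _ h₀ _ _ _ hb h).elim
      · obtain ⟨l₂, d₂, hl, hd₂, h⟩ := he₁ b l₁ d hb h
        exact ⟨l₂ + 1, d₂, by omega, hd₂, entry_inter1.2 ⟨l₂, rfl, h⟩⟩
    -- An intermediate-`0` node in place of the complete one would lengthen a run above it, so the
    -- node is dropped and `R₀` stripped; in the mirror case an intermediate-`1` node is harmless.
    · refine Or.inr ⟨R₀.strip, by rw [syms_strip, hs₀, h₁, List.append_nil], run0_strip R₀, fun m h =>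
        (hd₀ m (degreesOK_complete.1 h).1).strip, fun b l d hb h => ?_⟩
      obtain ⟨l₁, rfl, h | h⟩ := entry_complete.1 h
      · obtain ⟨l₂, d₂, hl, hd₂, h⟩ := he₀ b l₁ d hb h
        obtain ⟨l₃, hl₃, h⟩ := h.strip
        exact ⟨l₃, d₂, by omega, hd₂, h⟩
      · exact (absurd_entry _ h₁ _ _ _ hb h).elim
    · refine Or.inr ⟨complete R₀ R₁, by rw [syms, hs₀, hs₁], rfl, fun m h => ?_,
        fun b l d hb h => ?_⟩
      · rw [degreesOK_complete] at h ⊢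
        exact ⟨hd₀ m h.1, hd₁ m h.2⟩
      · obtain ⟨l₁, rfl, h | h⟩ := entry_complete.1 h
        · obtain ⟨l₂, d₂, hl, hd₂, h⟩ := he₀ b l₁ d hb h
          exact ⟨l₂ + 1, d₂, by omega, hd₂, entry_complete.2 ⟨l₂, rfl, Or.inl h⟩⟩
        · obtain ⟨l₂, d₂, hl, hd₂, h⟩ := he₁ b l₁ d hb h
          exact ⟨l₂ + 1, d₂, by omega, hd₂, entry_complete.2 ⟨l₂, rfl, Or.inr h⟩⟩

/-- Each node carries at most one symbol, and a binary tree has at most `2 ^ k - 1` nodes of depth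
below `k`. -/
theorem card_lt_two_pow_of_entry_lt [DecidableEq α] (k : ℕ) (T : CodeTree α) (s : Finset α)
    (hs : ∀ a ∈ s, ∃ l d, l < k ∧ T.Entry a l d) : s.card < 2 ^ k := by
  classical
  induction k generalizing T s with
  | zero =>
    have : s = ∅ := Finset.eq_empty_of_forall_notMem fun a ha => by
      obtain ⟨l, d, hl, -⟩ := hs a ha
      omega
    simp [this]
  | succ k ih =>
    have key : ∀ t : CodeTree α,
        (s.filter fun a => ∃ l d, l < k ∧ t.Entry a l d).card < 2 ^ k :=
      fun t => ih t _ fun a ha => (Finset.mem_filter.1 ha).2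
    have one : 1 ≤ 2 ^ k := Nat.one_le_two_pow
    rw [pow_succ]
    cases T with
    | leaf c =>
      have : s ⊆ {c} := fun a ha => by
        obtain ⟨l, d, -, h⟩ := hs a ha
        simpa using (entry_leaf.1 h).1
      have := Finset.card_le_card this
      rw [Finset.card_singleton] at this
      omega
    | master c t =>
      have : s ⊆ insert c (s.filter fun a => ∃ l d, l < k ∧ t.Entry a l d) := fun a ha => by
        obtain ⟨l, d, hl, h⟩ := hs a ha
        rcases entry_master.1 h with ⟨rfl, -⟩ | ⟨l, rfl, h'⟩
        · exact Finset.mem_insert_self _ _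
        · exact Finset.mem_insert_of_mem (Finset.mem_filter.2 ⟨ha, l, d, by omega, h'⟩)
      have := (Finset.card_le_card this).trans (Finset.card_insert_le _ _)
      have := key t
      omega
    | inter0 t =>
      have : s ⊆ s.filter fun a => ∃ l d, l < k ∧ t.Entry a l d := fun a ha => by
        obtain ⟨l, d, hl, h⟩ := hs a ha
        obtain ⟨l, rfl, h'⟩ := entry_inter0.1 h
        exact Finset.mem_filter.2 ⟨ha, l, d, by omega, h'⟩
      have := Finset.card_le_card this
      have := key t
      omega
    | inter1 t =>
      have : s ⊆ s.filter fun a => ∃ l d, l < k ∧ t.Entry a l d := fun a ha => by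
        obtain ⟨l, d, hl, h⟩ := hs a ha
        obtain ⟨l, rfl, h'⟩ := entry_inter1.1 h
        exact Finset.mem_filter.2 ⟨ha, l, d, by omega, h'⟩
      have := Finset.card_le_card this
      have := key t
      omega
    | complete t₀ t₁ =>
      have : s ⊆ (s.filter fun a => ∃ l d, l < k ∧ t₀.Entry a l d) ∪
          s.filter fun a => ∃ l d, l < k ∧ t₁.Entry a l d := fun a ha => by
        obtain ⟨l, d, hl, h⟩ := hs a ha
        obtain ⟨l, rfl, h | h⟩ := entry_complete.1 h
        · exact Finset.mem_union_left _ (Finset.mem_filter.2 ⟨ha, l, d, by omega, h⟩)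
        · exact Finset.mem_union_right _ (Finset.mem_filter.2 ⟨ha, l, d, by omega, h⟩)
      have := (Finset.card_le_card this).trans (Finset.card_union_le _ _)
      have := key t₀
      have := key t₁
      omega

/-! ### Building blocks, and recovering lengths and degrees -/

theorem exists_syms_eq (L : List α) (hL : L ≠ []) :
    ∃ T : CodeTree α, T.syms = L ∧ ∀ m, T.DegreesOK m := by
  induction L with
  | nil => exact (hL rfl).elim
  | cons a L ih =>
    rcases eq_or_ne L [] with rfl | h
    · exact ⟨leaf a, rfl, fun _ => degreesOK_leaf⟩
    · obtain ⟨T, hT, hd⟩ := ih h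
      exact ⟨complete (leaf a) T, by simp [syms, hT],
        fun m => degreesOK_complete.2 ⟨degreesOK_leaf, hd m⟩⟩

theorem exists_isInter1 (a : α) (k : ℕ) :
    ∃ T : CodeTree α, T.syms = [a] ∧ (∀ m, T.DegreesOK m) ∧
      T.IsInter1 (List.replicate k false) ∧ T.Entry a (k + 1) 0 := by
  induction k with
  | zero =>
    exact ⟨inter1 (leaf a), rfl, fun m => degreesOK_inter1.2 degreesOK_leaf,
      ⟨leaf a, by simp [subtreeAt]⟩, entry_inter1.2 ⟨0, rfl, entry_leaf.2 ⟨rfl, rfl, rfl⟩⟩⟩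
  | succ k ih =>
    obtain ⟨T, hs, hd, ⟨S, hS⟩, he⟩ := ih
    exact ⟨inter0 T, hs, fun m => degreesOK_inter0.2 (hd m),
      ⟨S, by simpa [List.replicate_succ, subtreeAt] using hS⟩, entry_inter0.2 ⟨_, rfl, he⟩⟩

/-- With `entry_codeLength`, this computes `codeLength` and `degree` from any exhibited entry,
although `codeword` is a choice. -/
theorem entry_unique {T : CodeTree α} (hT : T.syms.Nodup) {a : α} {l d l' d' : ℕ}
    (h : T.Entry a l d) (h' : T.Entry a l' d') : l = l' ∧ d = d' := by
  obtain ⟨w, S, h₁, h₂, rfl, rfl⟩ := h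
  obtain ⟨w', S', h₁', h₂', rfl, rfl⟩ := h'
  obtain rfl := nodup_syms_iff.1 hT a w w' ⟨S, h₁, h₂⟩ ⟨S', h₁', h₂'⟩
  rw [h₁] at h₁'
  obtain rfl := Option.some.inj h₁'
  exact ⟨rfl, rfl⟩

theorem entry_codeLength {T : CodeTree α} {a : α} (h : a ∈ T.syms) :
    T.Entry a (T.codeLength a) (T.degree a) := by
  obtain ⟨S, h₁, h₂⟩ : T.IsMasterOf (T.codeword a) a := Classical.epsilon_spec (mem_syms_iff.1 h)
  exact ⟨_, S, h₁, h₂, rfl, by simp [degree, h₁]⟩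

theorem DegreesOK.degree_lt {m : ℕ} (hm : 0 < m) {T : CodeTree α} (h : T.DegreesOK m) (a : α) :
    T.degree a < m := by
  rw [degree]
  split
  · next S hS =>
    cases S with
    | master b t => exact (h _ b t hS).2
    | _ => exact hm
  · exact hm

end CodeTree

/-! ### Type-`k` trees and their costs -/

open CodeTree

theorem mem_trees_iff {m n k : ℕ} {T : CodeTree (Fin n)} :
    T ∈ trees m n k ↔ T.DegreesOK m ∧ (T.syms.Nodup ∧ ∀ i, i ∈ T.syms) ∧
      (1 ≤ k → T.IsInter1 (List.replicate k false)) := by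
  refine and_congr_right fun _ => and_congr_left fun _ => ?_
  rw [nodup_syms_iff]
  constructor
  · exact fun h => ⟨fun a w w' h₁ h₂ => (h a).unique h₁ h₂, fun i => mem_syms_iff.2 (h i).exists⟩
  · rintro ⟨h, h'⟩ i
    obtain ⟨w, hw⟩ := mem_syms_iff.1 (h' i)
    exact ⟨w, hw, fun w' hw' => h i w' w hw' hw⟩

theorem trees_subset_trees_zero (m n k : ℕ) : trees m n k ⊆ trees m n 0 :=
  fun _ h => ⟨h.1, h.2.1, by simp⟩

theorem trees_zero_nonempty (m : ℕ) {n : ℕ} (hn : 0 < n) : (trees m n 0).Nonempty := by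
  obtain ⟨T, hT, hd⟩ := exists_syms_eq (List.finRange n)
    (List.ne_nil_of_mem (List.mem_finRange ⟨0, hn⟩))
  exact ⟨T, mem_trees_iff.2 ⟨hd m, by simp [hT, List.nodup_finRange], by simp⟩⟩

/-- The coordinates of `x`, extended by `0` to all indices. -/
noncomputable def extend (m : ℕ) (x : Finset.Icc 1 (m - 1) → ℝ) (j : ℕ) : ℝ :=
  if h : j ∈ Finset.Icc 1 (m - 1) then x ⟨j, h⟩ else 0

/-- Summing over symbols instead of degrees lets two trees be compared symbol by symbol. The default
`0` of `extend` covers both degree `0` and type `0`. -/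
theorem hyper_eq (m : ℕ) {n : ℕ} (p : Fin n → ℝ) (k : ℕ) (x : Finset.Icc 1 (m - 1) → ℝ)
    (T : CodeTree (Fin n)) :
    hyper m p k x T = ∑ i, p i * (T.codeLength i + extend m x (T.degree i)) - extend m x k := by
  have h : ∑ j : Finset.Icc 1 (m - 1), trans p T j * x j
      = ∑ i, p i * extend m x (T.degree i) := by
    simp only [trans, Finset.sum_filter, Finset.sum_mul]
    rw [Finset.sum_comm]
    refine Finset.sum_congr rfl fun i _ => ?_
    by_cases h : T.degree i ∈ Finset.Icc 1 (m - 1)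
    · rw [Finset.sum_eq_single ⟨_, h⟩, extend, dif_pos h, if_pos rfl]
      · intro j _ hj
        rw [if_neg, zero_mul]
        rintro h'
        exact hj (Subtype.ext h'.symm)
      · simp
    · rw [extend, dif_neg h, mul_zero]
      refine Finset.sum_eq_zero fun j _ => ?_
      rw [if_neg, zero_mul]
      intro h'
      exact h (h' ▸ j.2)
  simp only [hyper, h, avgLength, mul_add, Finset.sum_add_distrib]
  rw [extend]
  simp only [mul_comm]

/-- A type-`0` tree can be turned into a type-`k` tree at an additional cost of at most `1`. -/
theorem exists_mem_trees_le {m n k : ℕ} (hk : 1 ≤ k) (hn : 2 ^ k ≤ n)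
    (p : Fin n → ℝ) (hp : ∀ i, 0 ≤ p i) (hp1 : ∑ i, p i = 1)
    (y : ℕ → ℝ) (hy : ∀ j, 0 ≤ y j) (hy0 : y 0 = 0)
    {T : CodeTree (Fin n)} (hT : T ∈ trees m n 0) :
    ∃ T' ∈ trees m n k, ∑ i, p i * (T'.codeLength i + y (T'.degree i)) ≤
      ∑ i, p i * (T.codeLength i + y (T.degree i)) + 1 := by
  obtain ⟨hd, ⟨hnd, hmem⟩, -⟩ := mem_trees_iff.1 hT
  obtain ⟨a, ha⟩ : ∃ a, k ≤ T.codeLength a := by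
    by_contra! h
    have := card_lt_two_pow_of_entry_lt k T Finset.univ
      fun a _ => ⟨_, _, h a, entry_codeLength (hmem a)⟩
    simp at this
    omega
  have h2 : 2 ≤ n := le_trans (Nat.le_self_pow (by omega) 2) hn
  have : Nontrivial (Fin n) := Fin.nontrivial_iff_two_le.2 h2
  obtain ⟨b, hb⟩ := exists_ne a
  rcases exists_remove a T with h | ⟨R, hRs, -, hRd, hRe⟩
  · have : b ∈ T.syms.filter (· ≠ a) := List.mem_filter.2 ⟨hmem b, by simpa using hb⟩
    rw [h] at this
    exact (List.not_mem_nil this).elim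
  -- `k - 1` because `P` will hang from the `0`-edge of the new root.
  obtain ⟨P, hPs, hPd, ⟨S, hS⟩, hPe⟩ := exists_isInter1 a (k - 1)
  have hsyms : (complete P R).syms = a :: T.syms.filter (· ≠ a) := by
    rw [syms, hPs, hRs, List.singleton_append]
  have hnd' : (complete P R).syms.Nodup := by
    rw [hsyms, List.nodup_cons]
    exact ⟨by simp, hnd.filter _⟩
  have hmem' : ∀ i, i ∈ (complete P R).syms := fun i => by
    by_cases hi : i = a <;> simp [hsyms, hi, hmem]
  refine ⟨complete P R, mem_trees_iff.2 ⟨degreesOK_complete.2 ⟨hPd m, hRd m hd⟩, ⟨hnd', hmem'⟩,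
    fun _ => ⟨S, ?_⟩⟩, ?_⟩
  · obtain ⟨k, rfl⟩ := Nat.exists_eq_add_of_le' hk
    simpa [List.replicate_succ, subtreeAt] using hS
  · calc ∑ i, p i * ((complete P R).codeLength i + y ((complete P R).degree i))
        ≤ ∑ i, p i * ((T.codeLength i + y (T.degree i)) + 1) := by
          refine Finset.sum_le_sum fun i _ => mul_le_mul_of_nonneg_left ?_ (hp i)
          have hi := entry_codeLength (hmem' i)
          have hyT := hy (T.degree i)
          by_cases hia : i = a
          · subst hia
            obtain ⟨hl, hdeg⟩ := entry_unique hnd' hi (entry_complete.2 ⟨_, rfl, Or.inl hPe⟩)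
            rw [hl, hdeg, hy0]
            -- The new depth of `a` is `k + 1`; the choice of `a` with depth at least `k` is used
            -- here.
            have : ((k - 1 + 1 + 1 : ℕ) : ℝ) ≤ ((T.codeLength i + 1 : ℕ) : ℝ) :=
              Nat.cast_le.2 (by omega)
            push_cast at this ⊢
            linarith
          · obtain ⟨l, d, hl, hd, he⟩ := hRe i _ _ hia (entry_codeLength (hmem i))
            obtain ⟨hl', hdeg⟩ := entry_unique hnd' hi (entry_complete.2 ⟨_, rfl, Or.inr he⟩)
            rw [hl', hdeg]
            have hl : (l : ℝ) ≤ T.codeLength i := Nat.cast_le.2 hl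
            push_cast
            rcases hd with rfl | rfl
            · linarith
            · rw [hy0]
              linarith
      _ = ∑ i, p i * (T.codeLength i + y (T.degree i)) + 1 := by
          simp_rw [mul_add _ _ (1 : ℝ), mul_one, Finset.sum_add_distrib, hp1]

/-! ### Attainment of the minima -/

theorem isLeast_envelope {m n : ℕ} (hm : 0 < m) (p : Fin n → ℝ) (hp : ∀ i, 0 ≤ p i) (k : ℕ)
    (x : Finset.Icc 1 (m - 1) → ℝ) (hne : (trees m n k).Nonempty) :
    IsLeast (values m p k x) (envelope m p k x) := by
  let F (D : Fin n → Fin m) (L : Fin n → ℕ) : ℝ :=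
    ∑ i, p i * (L i + extend m x (D i)) - extend m x k
  have hF : ∀ D, Monotone (F D) := fun D L L' h => by
    refine sub_le_sub_right (Finset.sum_le_sum fun i _ => mul_le_mul_of_nonneg_left ?_ (hp i)) _
    have : (L i : ℝ) ≤ L' i := Nat.cast_le.2 (h i)
    linarith
  -- Dickson's lemma: `ℕ^n` is well-quasi-ordered, hence so is each monotone image; there are only
  -- finitely many degree vectors `D`.
  have hwf : (⋃ D, Set.range (F D)).IsWF := by
    have h := (Finset.univ.isPWO_bUnion (f := fun D => Set.range (F D))).2 fun D _ => by
      rw [← Set.image_univ]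
      exact (Set.isPWO_of_wellQuasiOrderedLE _).image_of_monotone (hF D)
    simpa using h.isWF
  have hsub : values m p k x ⊆ ⋃ D, Set.range (F D) := by
    rintro _ ⟨T, hT, rfl⟩
    exact Set.mem_iUnion.2 ⟨fun i => ⟨T.degree i, hT.1.degree_lt hm i⟩, T.codeLength,
      (hyper_eq m p k x T).symm⟩
  have hwf' := hwf.mono hsub
  have hne' : (values m p k x).Nonempty := hne.image _
  have h : IsLeast (values m p k x) (hwf'.min hne') :=
    ⟨hwf'.min_mem hne', fun v hv => hwf'.min_le hne' hv⟩
  rw [envelope, h.csInf_eq]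
  exact h

end AIFV

/-- Both lower envelopes are attained minima, and they are ordered as claimed on the two faces
`x_k = 0` and `x_k = 1` of the unit cube. -/
theorem mainTheorem7 (m n : ℕ) (hm : 2 ≤ m) (hn : 2 ^ m - 1 ≤ n)
    (p : Fin n → ℝ) (hp : ∀ i, 0 ≤ p i) (hp1 : ∑ i, p i = 1)
    (x : Finset.Icc 1 (m - 1) → ℝ) (hx : ∀ j, x j ∈ Set.Icc (0 : ℝ) 1)
    (k : Finset.Icc 1 (m - 1)) :
    (IsLeast (AIFV.values m p 0 x) (AIFV.envelope m p 0 x) ∧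
      IsLeast (AIFV.values m p k x) (AIFV.envelope m p k x)) ∧
    (x k = 0 → AIFV.envelope m p 0 x - AIFV.envelope m p k x ≤ 0) ∧
    (x k = 1 → AIFV.envelope m p k x - AIFV.envelope m p 0 x ≤ 0) := by
  obtain ⟨hk1, hkm⟩ := Finset.mem_Icc.1 k.2
  have hkn : 2 ^ (k : ℕ) ≤ n := by
    have h1 : 2 ^ (k : ℕ) ≤ 2 ^ (m - 1) := Nat.pow_le_pow_right (by norm_num) hkm
    have h2 : 2 ^ m = 2 ^ (m - 1) * 2 := by rw [← pow_succ, Nat.sub_add_cancel (by omega)]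
    have h3 : 1 ≤ 2 ^ (m - 1) := Nat.one_le_two_pow
    omega
  have hy : ∀ j, 0 ≤ AIFV.extend m x j := fun j => by
    rw [AIFV.extend]
    split
    · exact (hx _).1
    · exact le_rfl
  have hy0 : AIFV.extend m x 0 = 0 := by simp [AIFV.extend]
  have hyk : AIFV.extend m x k = x k := by simp [AIFV.extend]
  have key := fun T => AIFV.exists_mem_trees_le (m := m) hk1 hkn p hp hp1 _ hy hy0 (T := T)
  have hne := AIFV.trees_zero_nonempty m (lt_of_lt_of_le (by positivity) hkn)
  have hnek : (AIFV.trees m n k).Nonempty := by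
    obtain ⟨T, hT⟩ := hne
    obtain ⟨T', hT', -⟩ := key T hT
    exact ⟨T', hT'⟩
  have h0 := AIFV.isLeast_envelope (by omega) p hp 0 x hne
  have hk := AIFV.isLeast_envelope (by omega) p hp k x hnek
  refine ⟨⟨h0, hk⟩, fun hxk => ?_, fun hxk => ?_⟩
  · obtain ⟨T, hT, h⟩ := hk.1
    have := h0.2 ⟨T, AIFV.trees_subset_trees_zero m n k hT, rfl⟩
    rw [AIFV.hyper_eq, hyk, hxk] at h
    rw [AIFV.hyper_eq, hy0, h] at this
    linarith
  · obtain ⟨T, hT, h⟩ := h0.1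
    obtain ⟨T', hT', hle⟩ := key T hT
    have := hk.2 ⟨T', hT', rfl⟩
    rw [AIFV.hyper_eq, hyk, hxk] at this
    rw [AIFV.hyper_eq, hy0] at h
    linarith
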